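/- Let $\mathcal H_1,\mathcal H_2,\mathcal H$ be separable real Hilbert spaces and let $\mathcal B_2=\mathcal B_2(\mathcal H_1;\mathcal H_2)$ be the Hilbert space of Hilbert–Schmidt operators from $\mathcal H_1$ to $\mathcal H_2$, with inner product $\langle G,K\rangle=\sum_k\langle Ge_k,Ke_k\rangle$ for an orthonormal basis $(e_k)$ of $\mathcal H_1$. For $G\in\mathcal B_2$ let $\|G\|_*=\sum_k\sigma_k(G)\in[0,+\infty]$ be the nuclear norm (the sum of the singular values) and $\|G\|$ the operator norm. Let $N\ge 1$, let $\Phi:\mathcal B_2^N\to\mathcal H$ be a bounded linear operator with adjoint $\Phi^*:\mathcal H\to\mathcal B_2^N$, and let $z=\Phi F^\dagger$, where $F^\dagger=(\sigma_i\,u_i\otimes v_i)_{1\le i\le N}$ with $\sigma_i>0$ and unit vectors $u_i\in\mathcal H_1$, $v_i\in\mathcal H_2$; here $u\otimes v$ is the operator $a\mapsto\langle u,a\rangle v$. Consider the problems $$(\mathcal P)\quad \min_{F\in\mathcal B_2^N}\ \sum_{i=1}^N\|F_i\|_*\ \text{ s.t. }\ \Phi F=z,\qquad\qquad (\mathcal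 D)\quad \sup_{p\in\mathcal H}\ \langle p,z\rangle\ \text{ s.t. }\ \max_{1\le i\le N}\|(\Phi^*p)_i\|\le 1 .$$ **Proposition.** Problem $(\mathcal P)$ has a solution, and the values of $(\mathcal P)$ and $(\mathcal D)$ are equal. Moreover, if $p$ is a solution to $(\mathcal D)$, then every solution $F$ to $(\mathcal P)$ satisfies $$\langle F_i,(\Phi^*p)_i\rangle=\|F_i\|_*,\qquad 1\le i\le N. \tag{1}$$ Conversely, if $F\in\mathcal B_2^N$ and $p\in\mathcal H$ satisfy $\Phi F=z$, (1), and $\|(\Phi^*p)_i\|\le 1$ for every $1\le i\le N$, then $F$ is a solution to $(\mathcal P)$ and $p$ is a solution to $(\mathcal D)$. -/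

import Mathlib

set_option linter.unusedSectionVars false

open scoped ENNReal RealInnerProductSpace

noncomputable section

namespace NuclearMin

variable {E F : Type*} [NormedAddCommGroup E] [InnerProductSpace ℝ E] [CompleteSpace E]
  [NormedAddCommGroup F] [InnerProductSpace ℝ F] [CompleteSpace F]

/-! ### Hilbert-Schmidt operators -/

variable (E) in
/-- The index set of a chosen orthonormal (Hilbert) basis of `E`. -/
def basisSet : Set E := (exists_hilbertBasis ℝ E).choose

variable (E) in
/-- A chosen orthonormal (Hilbert) basis of `E`. The notions below do not depend on it, see
`isHilbertSchmidt_iff` and `HilbertSchmidt.inner_eq_tsum`. -/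
def stdBasis : HilbertBasis (basisSet E) ℝ E := (exists_hilbertBasis ℝ E).choose_spec.choose

/-- `G` is a Hilbert-Schmidt operator: `∑ ‖G eᵢ‖² < ∞` for an orthonormal basis `(eᵢ)` of `E`. -/
def IsHilbertSchmidt (G : E →L[ℝ] F) : Prop :=
  Summable fun i => ‖G (stdBasis E i)‖ ^ 2

theorem hasSum_sq_inner {ι : Type*} (b : HilbertBasis ι ℝ E) (x : E) :
    HasSum (fun i => ⟪b i, x⟫ ^ 2) (‖x‖ ^ 2) := by
  have h := b.hasSum_inner_mul_inner x x
  rw [real_inner_self_eq_norm_sq] at h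
  simpa [real_inner_comm, sq] using h

theorem ennreal_tsum_sq_inner {ι : Type*} (b : HilbertBasis ι ℝ E) (x : E) :
    ∑' i, ENNReal.ofReal (⟪b i, x⟫ ^ 2) = ENNReal.ofReal (‖x‖ ^ 2) := by
  have h := hasSum_sq_inner b x
  rw [← h.tsum_eq, ENNReal.ofReal_tsum_of_nonneg (fun i => sq_nonneg _) h.summable]

theorem tsum_norm_sq_eq_adjoint {ι κ : Type*} (b : HilbertBasis ι ℝ E) (c : HilbertBasis κ ℝ F)
    (G : E →L[ℝ] F) :
    ∑' i, ENNReal.ofReal (‖G (b i)‖ ^ 2) =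
      ∑' j, ENNReal.ofReal (‖ContinuousLinearMap.adjoint G (c j)‖ ^ 2) := by
  simp_rw [← ennreal_tsum_sq_inner c (G _), ← ennreal_tsum_sq_inner b (ContinuousLinearMap.adjoint G _)]
  rw [ENNReal.tsum_comm]
  refine tsum_congr fun j => tsum_congr fun i => ?_
  rw [ContinuousLinearMap.adjoint_inner_right, real_inner_comm]

theorem tsum_norm_sq_basis_indep {ι κ : Type*} (b : HilbertBasis ι ℝ E) (c : HilbertBasis κ ℝ E)
    (G : E →L[ℝ] F) :
    ∑' i, ENNReal.ofReal (‖G (b i)‖ ^ 2) = ∑' j, ENNReal.ofReal (‖G (c j)‖ ^ 2) := by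
  rw [tsum_norm_sq_eq_adjoint b (stdBasis F), tsum_norm_sq_eq_adjoint c (stdBasis F)]

theorem summable_iff_tsum_ofReal_ne_top {ι : Type*} {f : ι → ℝ} (hf : ∀ i, 0 ≤ f i) :
    Summable f ↔ ∑' i, ENNReal.ofReal (f i) ≠ ∞ := by
  constructor
  · intro h
    rw [← ENNReal.ofReal_tsum_of_nonneg hf h]
    exact ENNReal.ofReal_ne_top
  · intro h
    have := ENNReal.summable_toReal h
    simpa [ENNReal.toReal_ofReal (hf _)] using this

/-- Being Hilbert-Schmidt can be tested on any orthonormal basis. -/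
theorem isHilbertSchmidt_iff {ι : Type*} (b : HilbertBasis ι ℝ E) (G : E →L[ℝ] F) :
    IsHilbertSchmidt G ↔ Summable fun i => ‖G (b i)‖ ^ 2 := by
  rw [IsHilbertSchmidt, summable_iff_tsum_ofReal_ne_top (fun _ => sq_nonneg _),
    summable_iff_tsum_ofReal_ne_top (fun _ => sq_nonneg _),
    tsum_norm_sq_basis_indep (stdBasis E) b]

theorem IsHilbertSchmidt.memℓp {G : E →L[ℝ] F} (hG : IsHilbertSchmidt G) :
    Memℓp (fun i => G (stdBasis E i)) 2 := by
  refine memℓp_gen ?_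
  simpa [IsHilbertSchmidt] using hG

theorem isHilbertSchmidt_of_memℓp {G : E →L[ℝ] F} (hG : Memℓp (fun i => G (stdBasis E i)) 2) :
    IsHilbertSchmidt G := by
  have := hG.summable (by norm_num)
  simpa [IsHilbertSchmidt] using this

variable (E F) in
/-- The Hilbert-Schmidt operators, as a linear subspace of the bounded operators. -/
def hilbertSchmidtSubmodule : Submodule ℝ (E →L[ℝ] F) where
  carrier := {G | IsHilbertSchmidt G}
  zero_mem' := by simp [IsHilbertSchmidt, summable_zero]
  add_mem' {G K} hG hK := isHilbertSchmidt_of_memℓp (IsHilbertSchmidt.memℓp hG |>.add hK.memℓp)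
  smul_mem' c G hG := isHilbertSchmidt_of_memℓp (IsHilbertSchmidt.memℓp hG |>.const_smul c)

variable (E F) in
/-- The space of Hilbert-Schmidt operators from `E` to `F`. Its norm is the Hilbert-Schmidt norm
defined below (not the operator norm, which is `‖G.toCLM‖`). -/
def HilbertSchmidt : Type _ := hilbertSchmidtSubmodule E F

namespace HilbertSchmidt

instance : AddCommGroup (HilbertSchmidt E F) :=
  inferInstanceAs (AddCommGroup (hilbertSchmidtSubmodule E F))

instance : Module ℝ (HilbertSchmidt E F) :=
  inferInstanceAs (Module ℝ (hilbertSchmidtSubmodule E F))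

/-- The bounded operator underlying a Hilbert-Schmidt operator. -/
def toCLM : HilbertSchmidt E F →ₗ[ℝ] (E →L[ℝ] F) := (hilbertSchmidtSubmodule E F).subtype

theorem toCLM_injective : Function.Injective (toCLM : HilbertSchmidt E F → (E →L[ℝ] F)) :=
  Subtype.val_injective

theorem isHilbertSchmidt (G : HilbertSchmidt E F) : IsHilbertSchmidt (toCLM G) := G.2

theorem summable_inner (G K : HilbertSchmidt E F) :
    Summable fun i => ⟪toCLM G (stdBasis E i), toCLM K (stdBasis E i)⟫ :=
  lp.summable_inner (𝕜 := ℝ) (⟨_, G.isHilbertSchmidt.memℓp⟩ : lp (fun _ : basisSet E => F) 2)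
    ⟨_, K.isHilbertSchmidt.memℓp⟩

theorem ext_basis {A B : E →L[ℝ] F} (h : ∀ i, A (stdBasis E i) = B (stdBasis E i)) : A = B := by
  ext x
  have hx := (stdBasis E).hasSum_repr x
  have hA := hx.mapL A
  have hB := hx.mapL B
  simp only [map_smul, h] at hA hB
  exact hA.unique hB

/-- The inner product `⟪G, K⟫ = ∑ ⟪G eᵢ, K eᵢ⟫`, with `(eᵢ)` an orthonormal basis of `E`. -/
@[reducible] def core : InnerProductSpace.Core ℝ (HilbertSchmidt E F) where
  inner G K := ∑' i, ⟪toCLM G (stdBasis E i), toCLM K (stdBasis E i)⟫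
  conj_inner_symm G K := by simp [real_inner_comm]
  re_inner_nonneg G := tsum_nonneg fun i => real_inner_self_nonneg
  add_left G K L := by
    simp only [map_add, add_apply, inner_add_left]
    exact (summable_inner G L).tsum_add (summable_inner K L)
  smul_left G K c := by
    simp only [map_smul, smul_apply, real_inner_smul_left]
    exact tsum_mul_left
  definite G h := by
    have h0 := (summable_inner G G).hasSum
    change ∑' i, ⟪toCLM G (stdBasis E i), toCLM G (stdBasis E i)⟫ = 0 at h
    rw [h, hasSum_zero_iff_of_nonneg (fun i => real_inner_self_nonneg)] at h0
    refine toCLM_injective (ext_basis fun i => ?_)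
    have := congrFun h0 i
    simpa using this

instance : NormedAddCommGroup (HilbertSchmidt E F) := core.toNormedAddCommGroup

instance : InnerProductSpace ℝ (HilbertSchmidt E F) := InnerProductSpace.ofCore core.toCore

theorem inner_def (G K : HilbertSchmidt E F) :
    ⟪G, K⟫ = ∑' i, ⟪toCLM G (stdBasis E i), toCLM K (stdBasis E i)⟫ := rfl

variable (E F) in
/-- The isometry `G ↦ (G eᵢ)ᵢ` into the square-summable families of vectors of `F`. -/
def toLp : HilbertSchmidt E F →ₗᵢ[ℝ] lp (fun _ : basisSet E => F) 2 :=
  LinearMap.isometryOfInner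
    { toFun := fun G => ⟨fun i => toCLM G (stdBasis E i), G.isHilbertSchmidt.memℓp⟩
      map_add' := fun G K => by ext i; simp; rfl
      map_smul' := fun c G => by ext i; simp }
    (fun G K => lp.inner_eq_tsum (𝕜 := ℝ) _ _)

theorem toLp_surjective : Function.Surjective (toLp E F) := by
  intro y
  have hy : Summable fun i => ‖y i‖ ^ (2 : ℝ) := by
    simpa using (lp.memℓp y).summable (by norm_num)
  have hr : ∀ x : E, HasSum (fun i => |(stdBasis E).repr x i| ^ (2 : ℝ)) (‖x‖ ^ (2 : ℝ)) := by
    intro x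
    simpa [HilbertBasis.repr_apply_apply] using hasSum_sq_inner (stdBasis E) x
  have hs : ∀ x : E, Summable fun i => ‖(stdBasis E).repr x i • y i‖ := by
    intro x
    simp only [norm_smul, Real.norm_eq_abs]
    exact Real.summable_mul_of_Lp_Lq_of_nonneg Real.HolderConjugate.two_two
      (fun i => abs_nonneg _) (fun i => norm_nonneg _) (hr x).summable hy
  have hb : ∀ x : E, ‖∑' i, (stdBasis E).repr x i • y i‖ ≤
      (∑' i, ‖y i‖ ^ (2 : ℝ)) ^ (1 / (2 : ℝ)) * ‖x‖ := by
    intro x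
    refine (norm_tsum_le_tsum_norm (hs x)).trans ?_
    simp only [norm_smul, Real.norm_eq_abs]
    refine (Real.inner_le_Lp_mul_Lq_tsum_of_nonneg Real.HolderConjugate.two_two
      (fun i => abs_nonneg _) (fun i => norm_nonneg _) (hr x).summable hy).trans (le_of_eq ?_)
    rw [(hr x).tsum_eq, mul_comm, ← Real.rpow_mul (norm_nonneg _)]
    norm_num
  let A : E →L[ℝ] F := LinearMap.mkContinuous
    { toFun := fun x => ∑' i, (stdBasis E).repr x i • y i
      map_add' := fun x x' => by
        rw [← (hs x).of_norm.tsum_add (hs x').of_norm]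
        exact tsum_congr fun i => by simp [add_smul]
      map_smul' := fun c x => by
        rw [RingHom.id_apply, ← (hs x).of_norm.tsum_const_smul c]
        exact tsum_congr fun i => by simp [mul_smul] } _ hb
  have hA : ∀ i, A (stdBasis E i) = y i := by
    intro i
    change ∑' j, (stdBasis E).repr (stdBasis E i) j • y j = y i
    rw [tsum_eq_single i]
    · rw [HilbertBasis.repr_apply_apply, real_inner_self_eq_norm_sq, (stdBasis E).orthonormal.1 i]
      simp
    · intro j hj
      rw [HilbertBasis.repr_apply_apply, (stdBasis E).orthonormal.2 hj, zero_smul]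
  have hm : IsHilbertSchmidt A := by
    refine isHilbertSchmidt_of_memℓp ?_
    simp only [hA]
    exact lp.memℓp y
  refine ⟨⟨A, hm⟩, ?_⟩
  ext i
  exact hA i

/-- The Hilbert-Schmidt operators form a Hilbert space. -/
instance : CompleteSpace (HilbertSchmidt E F) :=
  (LinearIsometryEquiv.ofSurjective (toLp E F) toLp_surjective).toIsometryEquiv.completeSpace_iff.2
    inferInstance

theorem hasSum_norm_sq {ι : Type*} (b : HilbertBasis ι ℝ E) (G : HilbertSchmidt E F) :
    HasSum (fun i => ‖toCLM G (b i)‖ ^ 2) (‖G‖ ^ 2) := by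
  have hs := (isHilbertSchmidt_iff b _).1 G.isHilbertSchmidt
  refine hs.hasSum_iff.2 ?_
  have h := tsum_norm_sq_basis_indep b (stdBasis E) (toCLM G)
  rw [← ENNReal.ofReal_tsum_of_nonneg (fun _ => sq_nonneg _) hs,
    ← ENNReal.ofReal_tsum_of_nonneg (fun _ => sq_nonneg _) G.isHilbertSchmidt,
    ENNReal.ofReal_eq_ofReal_iff (tsum_nonneg fun _ => sq_nonneg _)
      (tsum_nonneg fun _ => sq_nonneg _)] at h
  rw [h, ← real_inner_self_eq_norm_sq, inner_def]
  simp only [real_inner_self_eq_norm_sq]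

/-- The inner product can be computed in any orthonormal basis. -/
theorem inner_eq_tsum {ι : Type*} (b : HilbertBasis ι ℝ E) (G K : HilbertSchmidt E F) :
    ⟪G, K⟫ = ∑' i, ⟪toCLM G (b i), toCLM K (b i)⟫ := by
  have h := ((hasSum_norm_sq b (G + K)).sub (hasSum_norm_sq b (G - K))).div_const 4
  have h1 : (‖G + K‖ ^ 2 - ‖G - K‖ ^ 2) / 4 = ⟪G, K⟫ := by
    rw [norm_add_sq_real, norm_sub_sq_real]; ring
  rw [h1] at h
  rw [← h.tsum_eq]
  refine tsum_congr fun i => ?_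
  simp only [map_add, map_sub, add_apply, sub_apply]
  rw [norm_add_sq_real, norm_sub_sq_real]; ring

/-- The rank-one operator `u ⊗ v : a ↦ ⟪u, a⟫ v`. -/
def tensor (u : E) (v : F) : HilbertSchmidt E F :=
  ⟨InnerProductSpace.rankOne ℝ v u, by
    change Summable _
    have h := (hasSum_sq_inner (stdBasis E) u).summable.mul_right (‖v‖ ^ 2)
    simpa [norm_smul, mul_pow, real_inner_comm] using h⟩

theorem tensor_apply (u a : E) (v : F) : toCLM (tensor u v) a = ⟪u, a⟫ • v := rfl

end HilbertSchmidt

/-! ### Singular values and nuclear norm -/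

/-- `G = ∑ σᵢ φᵢ ⊗ ψᵢ` is a singular value decomposition of `G`: the singular values `σ` form a
non-increasing sequence of non-negative numbers, and the `φᵢ` with `σᵢ ≠ 0`, as well as the `ψᵢ`
with `σᵢ ≠ 0`, are orthonormal. -/
structure IsSVD (G : E →L[ℝ] F) (σ : ℕ → ℝ) (φ : ℕ → E) (ψ : ℕ → F) : Prop where
  nonneg : ∀ i, 0 ≤ σ i
  antitone : Antitone σ
  orthonormal_left : Orthonormal ℝ fun i : {i // σ i ≠ 0} => φ i
  orthonormal_right : Orthonormal ℝ fun i : {i // σ i ≠ 0} => ψ i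
  hasSum : ∀ x, HasSum (fun i => (σ i * ⟪φ i, x⟫) • ψ i) (G x)

/-- `σ` is the sequence of singular values of `G`. -/
def IsSingularValueSeq (G : E →L[ℝ] F) (σ : ℕ → ℝ) : Prop := ∃ φ ψ, IsSVD G σ φ ψ

/-- The nuclear norm `∑ σᵢ(G) ∈ [0, ∞]` of a Hilbert-Schmidt operator, `σ(G)` being its sequence of
singular values. All sequences admitted by the infimum give the same sum, see
`nuclearNorm_eq`. -/
def nuclearNorm (G : HilbertSchmidt E F) : ℝ≥0∞ :=
  ⨅ (σ : ℕ → ℝ) (_ : IsSingularValueSeq G.toCLM σ), ∑' i, ENNReal.ofReal (σ i)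

theorem IsSVD.inner_apply {G : E →L[ℝ] F} {σ : ℕ → ℝ} {φ : ℕ → E} {ψ : ℕ → F}
    (h : IsSVD G σ φ ψ) (i : {i // σ i ≠ 0}) : ⟪ψ i, G (φ i)⟫ = σ i := by
  have h1 : G (φ i) = σ i • ψ i := by
    refine (h.hasSum (φ i)).unique ?_
    have h2 : σ i • ψ i = (σ i * ⟪φ i, φ i⟫) • ψ i := by
      rw [real_inner_self_eq_norm_sq, h.orthonormal_left.1 i]; simp
    rw [h2]
    refine hasSum_single (f := fun k => (σ k * ⟪φ k, φ i⟫) • ψ k) i.1 fun k hk => ?_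
    by_cases hk0 : σ k = 0
    · simp [hk0]
    · have := h.orthonormal_left.2 (i := ⟨k, hk0⟩) (j := i) (fun h => hk (congrArg Subtype.val h))
      simp only at this
      simp [this]
  rw [h1, real_inner_smul_right, real_inner_self_eq_norm_sq, h.orthonormal_right.1 i]; simp

theorem IsSVD.tsum_le {G : E →L[ℝ] F} {σ τ : ℕ → ℝ} {φ a : ℕ → E} {ψ b : ℕ → F}
    (h : IsSVD G σ φ ψ) (h' : IsSVD G τ a b) :
    ∑' i, ENNReal.ofReal (σ i) ≤ ∑' j, ENNReal.ofReal (τ j) := by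
  by_cases hτ : ∑' j, ENNReal.ofReal (τ j) = ∞
  · rw [hτ]; exact le_top
  have hτs : Summable τ := (summable_iff_tsum_ofReal_ne_top h'.nonneg).2 hτ
  have e : ∑' i, ENNReal.ofReal (σ i) = ∑' i : {i // σ i ≠ 0}, ENNReal.ofReal (σ i) := by
    symm
    refine tsum_subtype_eq_of_support_subset (f := fun i => ENNReal.ofReal (σ i))
      (s := {i | σ i ≠ 0}) fun i hi hi0 => hi ?_
    simp [hi0]
  rw [e, ENNReal.tsum_eq_iSup_sum, ← ENNReal.ofReal_tsum_of_nonneg h'.nonneg hτs]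
  refine iSup_le fun s => ?_
  rw [← ENNReal.ofReal_sum_of_nonneg fun (i : {i // σ i ≠ 0}) _ => h.nonneg i]
  refine ENNReal.ofReal_le_ofReal ?_
  have hj : HasSum (fun j => ∑ i ∈ s, (τ j * ⟪a j, φ i⟫) * ⟪ψ i, b j⟫) (∑ i ∈ s, σ i) := by
    refine hasSum_sum fun i _ => ?_
    have := (h'.hasSum (φ i)).mapL (innerSL ℝ (ψ i))
    simpa [h.inner_apply i, real_inner_smul_right] using this
  refine hasSum_le (fun j => ?_) hj hτs.hasSum
  by_cases hj0 : τ j = 0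
  · simp [hj0]
  have h1 : ∑ i ∈ s, ⟪φ i, a j⟫ ^ 2 ≤ 1 := by
    have := h.orthonormal_left.sum_inner_products_le (a j) (s := s)
    simpa [h'.orthonormal_left.1 ⟨j, hj0⟩] using this
  have h2 : ∑ i ∈ s, ⟪ψ i, b j⟫ ^ 2 ≤ 1 := by
    have := h.orthonormal_right.sum_inner_products_le (b j) (s := s)
    simpa [h'.orthonormal_right.1 ⟨j, hj0⟩] using this
  calc ∑ i ∈ s, (τ j * ⟪a j, φ i⟫) * ⟪ψ i, b j⟫
      ≤ ∑ i ∈ s, τ j * ((⟪φ i, a j⟫ ^ 2 + ⟪ψ i, b j⟫ ^ 2) / 2) := by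
        refine Finset.sum_le_sum fun i _ => ?_
        rw [mul_assoc, real_inner_comm]
        refine mul_le_mul_of_nonneg_left ?_ (h'.nonneg j)
        nlinarith [sq_nonneg (⟪φ i, a j⟫ - ⟪ψ i, b j⟫)]
    _ = τ j * ((∑ i ∈ s, ⟪φ i, a j⟫ ^ 2 + ∑ i ∈ s, ⟪ψ i, b j⟫ ^ 2) / 2) := by
        rw [← Finset.mul_sum, ← Finset.sum_div, Finset.sum_add_distrib]
    _ ≤ τ j := by nlinarith [h'.nonneg j]

/-- The nuclear norm is the sum of the singular values in any singular value decomposition. -/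
theorem nuclearNorm_eq {G : HilbertSchmidt E F} {σ : ℕ → ℝ} (h : IsSingularValueSeq G.toCLM σ) :
    nuclearNorm G = ∑' i, ENNReal.ofReal (σ i) := by
  obtain ⟨φ, ψ, h⟩ := h
  refine le_antisymm (iInf₂_le σ ⟨φ, ψ, h⟩) (le_iInf₂ fun τ h' => ?_)
  obtain ⟨a, b, h'⟩ := h'
  exact h.tsum_le h'

/-! ### The primal and dual problems -/

/-- The Hilbert space of `N`-tuples of Hilbert-Schmidt operators, with `⟪X, Y⟫ = ∑ ⟪Xᵢ, Yᵢ⟫`. -/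
abbrev OpTuple (N : ℕ) (E F : Type*) [NormedAddCommGroup E] [InnerProductSpace ℝ E]
    [CompleteSpace E] [NormedAddCommGroup F] [InnerProductSpace ℝ F] [CompleteSpace F] : Type _ :=
  PiLp 2 fun _ : Fin N => HilbertSchmidt E F

variable {H : Type*} [NormedAddCommGroup H] [InnerProductSpace ℝ H] [CompleteSpace H] {N : ℕ}

/-- The tuple `(σᵢ uᵢ ⊗ vᵢ)ᵢ`. -/
def rankOneTuple (σ : Fin N → ℝ) (u : Fin N → E) (v : Fin N → F) : OpTuple N E F :=
  WithLp.toLp 2 fun i => σ i • HilbertSchmidt.tensor (u i) (v i)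

/-- The primal objective `∑ ‖Xᵢ‖_*`. -/
def objective (X : OpTuple N E F) : ℝ≥0∞ := ∑ i, nuclearNorm (X i)

/-- `X` is a solution to: minimize `∑ ‖Xᵢ‖_*` subject to `Φ X = z`. -/
def IsPrimalSolution (Φ : OpTuple N E F →L[ℝ] H) (z : H) (X : OpTuple N E F) : Prop :=
  Φ X = z ∧ ∀ Y, Φ Y = z → objective X ≤ objective Y

/-- The value of: minimize `∑ ‖Xᵢ‖_*` subject to `Φ X = z`. -/
def primalValue (Φ : OpTuple N E F →L[ℝ] H) (z : H) : EReal :=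
  ⨅ (X : OpTuple N E F) (_ : Φ X = z), (objective X : EReal)

/-- The dual constraint `maxᵢ ‖(Φ* p)ᵢ‖ ≤ 1`, for the operator norm. -/
def DualFeasible (Φ : OpTuple N E F →L[ℝ] H) (p : H) : Prop :=
  ∀ i, ‖(ContinuousLinearMap.adjoint Φ p i).toCLM‖ ≤ 1

/-- `p` is a solution to: maximize `⟪p, z⟫` subject to `maxᵢ ‖(Φ* p)ᵢ‖ ≤ 1`. -/
def IsDualSolution (Φ : OpTuple N E F →L[ℝ] H) (z p : H) : Prop :=
  DualFeasible Φ p ∧ ∀ q, DualFeasible Φ q → ⟪q, z⟫ ≤ ⟪p, z⟫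

/-- The value of: maximize `⟪p, z⟫` subject to `maxᵢ ‖(Φ* p)ᵢ‖ ≤ 1`. -/
def dualValue (Φ : OpTuple N E F →L[ℝ] H) (z : H) : EReal :=
  ⨆ (p : H) (_ : DualFeasible Φ p), ((⟪p, z⟫ : ℝ) : EReal)

end NuclearMin

end

/-!
The nuclear norm is the dual of the operator norm:
`‖G‖_* = sup {⟪G, K⟫ | K Hilbert-Schmidt, ‖K‖ ≤ 1}` (`nuclearNorm_eq_iSup`). The inequality `≥` is
read off from a singular value decomposition of `G`; for `≤`, the finite sums `∑ φₖ ⊗ ψₖ` are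
contractions which reach the partial sums of the singular values. This needs every Hilbert-Schmidt
operator to have a singular value decomposition (`exists_isSingularValueSeq`). It is built greedily:
`G` is compact, so it attains its norm at a unit vector `x`, an eigenvector of `G* G`; subtracting
`x ⊗ G x` leaves an operator that vanishes at `x`, has range orthogonal to `G x`, and whose squared
Hilbert-Schmidt norm has dropped by `‖G‖²`, so that iterating exhausts `G`.

As a supremum of continuous linear functionals the objective is convex and lower semicontinuous, and
its sublevel sets are bounded, since `‖G‖_HS ≤ ‖G‖_*`. In a Hilbert space a decreasing sequence of
nonempty bounded closed convex sets has a common point (`nonempty_iInter_of_antitone_convex`), which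
replaces weak compactness in two places. Applied to the feasible points of almost minimal objective
it gives a primal solution. It also shows that `Φ` maps sublevel sets to closed sets; if `c > 0` is
less than the primal value, the image of the sublevel set of level `c` is then closed, convex and
does not contain `z`, and a separating functional, rescaled, is a dual feasible point of value at
least `c` (`exists_dualFeasible_le_inner`). This is strong duality.

For dual feasible `p` one has `⟪Xᵢ, (Φ* p)ᵢ⟫ ≤ ‖Xᵢ‖_*` for each `i`, with sums `⟪p, Φ X⟫` and the
objective. Hence weak duality; and if `Φ X = z`, the two sums agree, that is, both points are
optimal, exactly when all of these inequalities are equalities.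
-/

noncomputable section

namespace NuclearMin

variable {E F : Type*} [NormedAddCommGroup E] [InnerProductSpace ℝ E] [CompleteSpace E]
  [NormedAddCommGroup F] [InnerProductSpace ℝ F] [CompleteSpace F]

/-! ### Rank-one operators and the operator norm -/

namespace HilbertSchmidt

theorem inner_tensor_left (u : E) (v : F) (K : HilbertSchmidt E F) :
    ⟪tensor u v, K⟫ = ⟪v, toCLM K u⟫ := by
  rw [inner_def]
  have h := (((stdBasis E).hasSum_repr u).mapL (toCLM K)).mapL (innerSL ℝ v)
  refine Eq.trans (tsum_congr fun i => ?_) h.tsum_eq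
  simp [tensor_apply, HilbertBasis.repr_apply_apply, real_inner_smul_right, real_inner_comm]

theorem inner_tensor_right (u : E) (v : F) (K : HilbertSchmidt E F) :
    ⟪K, tensor u v⟫ = ⟪toCLM K u, v⟫ := by
  rw [real_inner_comm, inner_tensor_left, real_inner_comm]

theorem norm_tensor (u : E) (v : F) : ‖tensor u v‖ = ‖u‖ * ‖v‖ := by
  have h : ‖tensor u v‖ ^ 2 = (‖u‖ * ‖v‖) ^ 2 := by
    rw [← real_inner_self_eq_norm_sq, inner_tensor_left, tensor_apply, real_inner_smul_right,
      real_inner_self_eq_norm_sq, real_inner_self_eq_norm_sq, mul_pow]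
  exact (pow_left_inj₀ (norm_nonneg _) (by positivity) two_ne_zero).1 h

theorem norm_apply_le (G : HilbertSchmidt E F) (x : E) : ‖toCLM G x‖ ≤ ‖G‖ * ‖x‖ := by
  rcases eq_or_ne (toCLM G x) 0 with h0 | h0
  · rw [h0, norm_zero]; positivity
  have h := real_inner_le_norm G (tensor x (toCLM G x))
  rw [inner_tensor_right, real_inner_self_eq_norm_sq, norm_tensor] at h
  have := norm_pos_iff.2 h0
  nlinarith

theorem norm_toCLM_le (G : HilbertSchmidt E F) : ‖toCLM G‖ ≤ ‖G‖ :=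
  ContinuousLinearMap.opNorm_le_bound _ (norm_nonneg _) (norm_apply_le G)

variable (E F) in
/-- The inclusion of the Hilbert-Schmidt operators into the bounded operators, as a bounded
linear map. -/
def toCLML : HilbertSchmidt E F →L[ℝ] (E →L[ℝ] F) :=
  LinearMap.mkContinuous toCLM 1 fun G => by simpa using norm_toCLM_le G

@[simp]
theorem toCLML_apply (G : HilbertSchmidt E F) : toCLML E F G = toCLM G := rfl

/-- The expansion `G = ∑ eᵢ ⊗ G eᵢ` converges in the Hilbert-Schmidt norm, which makes `G` a limit
of finite-rank operators. -/
theorem hasSum_tensor (G : HilbertSchmidt E F) :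
    HasSum (fun i => tensor (stdBasis E i : E) (toCLM G (stdBasis E i))) G := by
  classical
  let e := LinearIsometryEquiv.ofSurjective (toLp E F) toLp_surjective
  have h := (lp.hasSum_single (E := fun _ : basisSet E => F) (p := 2) (by norm_num)
    (e G)).mapL (e.symm : _ →L[ℝ] HilbertSchmidt E F)
  have hG : (e.symm : _ →L[ℝ] HilbertSchmidt E F) (e G) = G := e.symm_apply_apply G
  rw [hG] at h
  refine h.congr_fun fun i => ?_
  refine e.injective ?_
  refine Eq.trans ?_ (e.apply_symm_apply _).symm
  ext j
  change toCLM (tensor (stdBasis E i : E) (toCLM G (stdBasis E i))) (stdBasis E j) =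
    (lp.single 2 i (toCLM G (stdBasis E i)) : lp (fun _ : basisSet E => F) 2) j
  rw [tensor_apply]
  rcases eq_or_ne j i with rfl | hij
  · simp [(stdBasis E).orthonormal.1 j]
  · rw [(stdBasis E).orthonormal.2 hij.symm, zero_smul, lp.single_apply_ne _ _ _ hij]

theorem isCompactOperator (G : HilbertSchmidt E F) : IsCompactOperator (toCLM G) := by
  have h := (hasSum_tensor G).mapL (toCLML E F)
  have hc := (compactOperator (RingHom.id ℝ) E F).isClosed_topologicalClosure
  rw [compactOperator_topologicalClosure] at hc
  refine hc.mem_of_tendsto h (Filter.Eventually.of_forall fun s => ?_)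
  refine Submodule.sum_mem _ fun i _ => ?_
  have hr := isCompactOperator_of_locallyCompactSpace_rng
    (ContinuousLinearMap.toSpanSingleton ℝ (toCLM G (stdBasis E i)))
  exact hr.comp_clm (innerSL ℝ (stdBasis E i : E))

end HilbertSchmidt

/-! ### Norm attainment -/

/-- A nonzero compact operator attains its norm. With `y` a point of maximal norm in the closure of
the image of the unit ball, the vector `‖G‖⁻² G* y` does it. -/
theorem exists_norm_eq_one_norm_apply_eq {G : E →L[ℝ] F} (hG : IsCompactOperator G)
    (h0 : G ≠ 0) : ∃ x, ‖x‖ = 1 ∧ ‖G x‖ = ‖G‖ := by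
  have hs : 0 < ‖G‖ := norm_pos_iff.2 h0
  have hK : IsCompact (closure (G '' Metric.closedBall 0 1)) :=
    hG.isCompact_closure_image_closedBall 1
  obtain ⟨y, hy, hmax⟩ := hK.exists_isMaxOn
    ((Metric.nonempty_closedBall.2 zero_le_one).image G).closure continuous_norm.continuousOn
  have hball : ∀ x : E, ‖x‖ ≤ 1 → G x ∈ closure (G '' Metric.closedBall 0 1) := fun x hx =>
    subset_closure ⟨x, by simpa using hx, rfl⟩
  have hy1 : ‖G‖ ≤ ‖y‖ := by
    refine G.opNorm_le_of_unit_norm (norm_nonneg _) fun x hx => hmax (hball x hx.le)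
  have hy2 : ‖y‖ ≤ ‖G‖ := by
    have : closure (G '' Metric.closedBall 0 1) ⊆ Metric.closedBall 0 ‖G‖ := by
      refine closure_minimal ?_ Metric.isClosed_closedBall
      rintro _ ⟨x, hx, rfl⟩
      simpa using G.le_of_opNorm_le_of_le le_rfl (by simpa using hx : ‖x‖ ≤ 1)
    simpa using this hy
  have hyG : ‖y‖ = ‖G‖ := le_antisymm hy2 hy1
  set a := ContinuousLinearMap.adjoint G y with ha
  -- `⟪y, w⟫ ≤ ‖a‖` on the image of the unit ball, so also on its closure, in particular at `y`.
  have hle : ‖G‖ ^ 2 ≤ ‖a‖ := by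
    have : closure (G '' Metric.closedBall 0 1) ⊆ {w | ⟪y, w⟫ ≤ ‖a‖} := by
      refine closure_minimal ?_ (isClosed_le (by fun_prop) continuous_const)
      rintro _ ⟨x, hx, rfl⟩
      change ⟪y, G x⟫ ≤ ‖a‖
      rw [← ContinuousLinearMap.adjoint_inner_left]
      refine (real_inner_le_norm _ _).trans ?_
      exact mul_le_of_le_one_right (norm_nonneg _) (by simpa using hx)
    have := this hy
    rwa [Set.mem_ofPred_eq, real_inner_self_eq_norm_sq, hyG] at this
  have hge : ‖a‖ ≤ ‖G‖ ^ 2 := by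
    have := (ContinuousLinearMap.adjoint G).le_opNorm y
    rwa [LinearIsometryEquiv.norm_map, hyG, ← sq] at this
  have hna : ‖a‖ = ‖G‖ ^ 2 := le_antisymm hge hle
  have hGa : ‖G‖ ^ 3 ≤ ‖G a‖ := by
    have h := real_inner_le_norm y (G a)
    rw [← ContinuousLinearMap.adjoint_inner_left, ← ha, real_inner_self_eq_norm_sq, hna, hyG] at h
    nlinarith
  have hx : ‖(‖G‖ ^ 2)⁻¹ • a‖ = 1 := by
    rw [norm_smul, hna, Real.norm_of_nonneg (by positivity)]
    field_simp
  refine ⟨(‖G‖ ^ 2)⁻¹ • a, hx, le_antisymm (G.unit_le_opNorm _ hx.le) ?_⟩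
  rw [map_smul, norm_smul, Real.norm_of_nonneg (by positivity), inv_mul_eq_div,
    le_div_iff₀ (by positivity)]
  nlinarith

/-- A unit vector at which `G` attains its norm is an eigenvector of `G* G`. -/
theorem inner_apply_apply_of_norm_apply_eq {G : E →L[ℝ] F} {x : E} (hx : ‖x‖ = 1)
    (hGx : ‖G x‖ = ‖G‖) (w : E) : ⟪G x, G w⟫ = ‖G‖ ^ 2 * ⟪x, w⟫ := by
  set b := ContinuousLinearMap.adjoint G (G x) with hb
  have h1 : ‖b‖ ≤ ‖G‖ ^ 2 := by
    have := (ContinuousLinearMap.adjoint G).le_opNorm (G x)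
    rwa [LinearIsometryEquiv.norm_map, hGx, ← sq] at this
  have h2 : ⟪b, x⟫ = ‖G‖ ^ 2 := by
    rw [hb, ContinuousLinearMap.adjoint_inner_left, real_inner_self_eq_norm_sq, hGx]
  -- Equality holds in the Cauchy-Schwarz inequality for `b = G* G x` and `x`.
  have h3 : b - ‖G‖ ^ 2 • x = 0 := by
    have h : ‖b - ‖G‖ ^ 2 • x‖ ^ 2 ≤ 0 := by
      rw [norm_sub_sq_real, real_inner_smul_right, h2, norm_smul, hx,
        Real.norm_of_nonneg (by positivity)]
      nlinarith [norm_nonneg b]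
    exact norm_eq_zero.1 (pow_eq_zero_iff two_ne_zero |>.1 (le_antisymm h (sq_nonneg _)))
  rw [← ContinuousLinearMap.adjoint_inner_left, ← hb, sub_eq_zero.1 h3, real_inner_smul_left]

/-! ### Existence of singular value decompositions -/

namespace HilbertSchmidt

open Classical in
/-- A unit vector at which `G` attains its operator norm; zero if `G = 0`. -/
def topVector (G : HilbertSchmidt E F) : E :=
  if h : toCLM G = 0 then 0
  else (exists_norm_eq_one_norm_apply_eq G.isCompactOperator h).choose

theorem topVector_spec {G : HilbertSchmidt E F} (h : toCLM G ≠ 0) :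
    ‖topVector G‖ = 1 ∧ ‖toCLM G (topVector G)‖ = ‖toCLM G‖ := by
  rw [topVector, dif_neg h]
  exact (exists_norm_eq_one_norm_apply_eq G.isCompactOperator h).choose_spec

theorem norm_apply_topVector (G : HilbertSchmidt E F) :
    ‖toCLM G (topVector G)‖ = ‖toCLM G‖ := by
  by_cases h : toCLM G = 0
  · simp [h]
  · exact (topVector_spec h).2

theorem norm_toCLM_mul_norm_topVector (G : HilbertSchmidt E F) :
    ‖toCLM G‖ * ‖topVector G‖ = ‖toCLM G‖ := by
  by_cases h : toCLM G = 0
  · simp [h]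
  · rw [(topVector_spec h).1, mul_one]

theorem inner_apply_topVector (G : HilbertSchmidt E F) (w : E) :
    ⟪toCLM G (topVector G), toCLM G w⟫ = ‖toCLM G‖ ^ 2 * ⟪topVector G, w⟫ := by
  by_cases h : toCLM G = 0
  · simp [h]
  · exact inner_apply_apply_of_norm_apply_eq (topVector_spec h).1 (topVector_spec h).2 w

/-- `G` with the leading term `x ⊗ G x` of its singular value decomposition removed, `x` being its
top vector. -/
def deflate (G : HilbertSchmidt E F) : HilbertSchmidt E F :=
  G - tensor (topVector G) (toCLM G (topVector G))

theorem deflate_apply (G : HilbertSchmidt E F) (w : E) :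
    toCLM (deflate G) w = toCLM G (w - ⟪topVector G, w⟫ • topVector G) := by
  rw [deflate, map_sub, sub_apply, tensor_apply, map_sub, map_smul]

theorem norm_toCLM_deflate_le (G : HilbertSchmidt E F) : ‖toCLM (deflate G)‖ ≤ ‖toCLM G‖ := by
  by_cases h : toCLM G = 0
  · have : toCLM (deflate G) = 0 := by
      ext w; simp [deflate_apply, h]
    simp [this]
  refine ContinuousLinearMap.opNorm_le_bound _ (norm_nonneg _) fun w => ?_
  rw [deflate_apply]
  refine (toCLM G).le_opNorm_of_le ?_
  have hx := (topVector_spec h).1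
  refine (sq_le_sq₀ (norm_nonneg _) (norm_nonneg _)).1 ?_
  rw [norm_sub_sq_real, real_inner_smul_right, norm_smul, mul_pow, hx, real_inner_comm,
    Real.norm_eq_abs, sq_abs]
  nlinarith [sq_nonneg ⟪topVector G, w⟫]

theorem norm_deflate_sq (G : HilbertSchmidt E F) :
    ‖deflate G‖ ^ 2 = ‖G‖ ^ 2 - ‖toCLM G‖ ^ 2 := by
  rw [deflate, norm_sub_sq_real, inner_tensor_right, real_inner_self_eq_norm_sq, norm_tensor,
    norm_apply_topVector, mul_comm ‖topVector G‖, norm_toCLM_mul_norm_topVector]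
  ring

theorem deflate_apply_topVector (G : HilbertSchmidt E F) :
    toCLM (deflate G) (topVector G) = 0 := by
  rw [deflate_apply]
  by_cases h : toCLM G = 0
  · simp [h]
  · simp [(topVector_spec h).1]

/-- The top vector lies in the range of `G* G`, so it is orthogonal to the kernel of `G`. -/
theorem inner_topVector_eq_zero {G : HilbertSchmidt E F} (h : toCLM G ≠ 0) {a : E}
    (ha : toCLM G a = 0) : ⟪topVector G, a⟫ = 0 := by
  have h1 := inner_apply_topVector G a
  rw [ha, inner_zero_right] at h1
  have := norm_pos_iff.2 h
  exact (mul_eq_zero.1 h1.symm).resolve_left (by positivity)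

theorem deflate_apply_eq_zero {G : HilbertSchmidt E F} {a : E} (ha : toCLM G a = 0) :
    toCLM (deflate G) a = 0 := by
  rw [deflate_apply]
  by_cases h : toCLM G = 0
  · simp [h]
  · simp [inner_topVector_eq_zero h ha, ha]

theorem inner_apply_topVector_deflate (G : HilbertSchmidt E F) (w : E) :
    ⟪toCLM G (topVector G), toCLM (deflate G) w⟫ = 0 := by
  rw [deflate_apply, inner_apply_topVector]
  by_cases h : toCLM G = 0
  · simp [h]
  · simp [inner_sub_right, real_inner_smul_right, (topVector_spec h).1]

/-- The operators obtained by successively removing the leading singular terms of `G`. -/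
def residual (G : HilbertSchmidt E F) (n : ℕ) : HilbertSchmidt E F := deflate^[n] G

theorem residual_succ (G : HilbertSchmidt E F) (n : ℕ) :
    residual G (n + 1) = deflate (residual G n) := Function.iterate_succ_apply' _ _ _

theorem residual_apply_topVector (G : HilbertSchmidt E F) {k m : ℕ} (h : k < m) :
    toCLM (residual G m) (topVector (residual G k)) = 0 := by
  induction m, h using Nat.le_induction with
  | base => rw [residual_succ, deflate_apply_topVector]
  | succ m _ ih => rw [residual_succ, deflate_apply_eq_zero ih]

theorem exists_residual_apply_eq (G : HilbertSchmidt E F) {k m : ℕ} (h : k ≤ m) (w : E) :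
    ∃ w', toCLM (residual G m) w = toCLM (residual G k) w' := by
  induction m, h using Nat.le_induction generalizing w with
  | base => exact ⟨w, rfl⟩
  | succ m _ ih => rw [residual_succ, deflate_apply]; exact ih _

theorem inner_residual_apply_topVector (G : HilbertSchmidt E F) {k m : ℕ} (h : k < m) (w : E) :
    ⟪toCLM (residual G k) (topVector (residual G k)), toCLM (residual G m) w⟫ = 0 := by
  obtain ⟨w', hw'⟩ := exists_residual_apply_eq G (Nat.succ_le_of_lt h) w
  rw [hw', residual_succ, inner_apply_topVector_deflate]

/-- Deflation is an orthogonal subtraction, so the squared norms of the removed terms add up. -/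
theorem sum_sq_norm_residual (G : HilbertSchmidt E F) (n : ℕ) :
    ∑ k ∈ Finset.range n, ‖toCLM (residual G k)‖ ^ 2 = ‖G‖ ^ 2 - ‖residual G n‖ ^ 2 := by
  induction n with
  | zero => simp [residual]
  | succ n ih => rw [Finset.sum_range_succ, ih, residual_succ, norm_deflate_sq]; ring

theorem summable_sq_norm_residual (G : HilbertSchmidt E F) :
    Summable fun k => ‖toCLM (residual G k)‖ ^ 2 := by
  refine summable_of_sum_range_le (c := ‖G‖ ^ 2) (fun _ => sq_nonneg _) fun n => ?_
  rw [sum_sq_norm_residual]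
  linarith [sq_nonneg ‖residual G n‖]

theorem sum_residual_apply (G : HilbertSchmidt E F) (n : ℕ) (x : E) :
    ∑ k ∈ Finset.range n, ⟪topVector (residual G k), x⟫ •
      toCLM (residual G k) (topVector (residual G k)) = toCLM G x - toCLM (residual G n) x := by
  induction n with
  | zero => simp [residual]
  | succ n ih =>
    rw [Finset.sum_range_succ, ih, residual_succ, deflate_apply, map_sub, map_smul]
    abel

theorem tendsto_residual_apply (G : HilbertSchmidt E F) (x : E) :
    Filter.Tendsto (fun n => toCLM (residual G n) x) Filter.atTop (nhds 0) := by
  have h1 : Filter.Tendsto (fun n => ‖toCLM (residual G n)‖) Filter.atTop (nhds 0) := by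
    have := (summable_sq_norm_residual G).tendsto_atTop_zero.sqrt
    simpa [Real.sqrt_sq] using this
  refine squeeze_zero_norm (fun n => (toCLM (residual G n)).le_opNorm x) ?_
  simpa using h1.mul_const ‖x‖

/-- Every Hilbert-Schmidt operator has a singular value decomposition: take the norms of the
residuals as singular values, with the vectors at which these norms are attained. -/
theorem exists_isSingularValueSeq (G : HilbertSchmidt E F) :
    ∃ σ, IsSingularValueSeq (toCLM G) σ := by
  set σ : ℕ → ℝ := fun k => ‖toCLM (residual G k)‖ with hσ
  set φ : ℕ → E := fun k => topVector (residual G k) with hφ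
  set ψ : ℕ → F := fun k => (σ k)⁻¹ • toCLM (residual G k) (φ k) with hψ
  have hne : ∀ i : {i // σ i ≠ 0}, toCLM (residual G i) ≠ 0 := fun i => norm_ne_zero_iff.1 i.2
  have hσψ : ∀ k, σ k • ψ k = toCLM (residual G k) (φ k) := by
    intro k
    by_cases h : σ k = 0
    · have : toCLM (residual G k) = 0 := norm_eq_zero.1 h
      simp [h, this]
    · rw [hψ, smul_inv_smul₀ h]
  have hleft : Orthonormal ℝ fun i : {i // σ i ≠ 0} => φ i := by
    refine ⟨fun i => (topVector_spec (hne i)).1, fun i j hij => ?_⟩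
    rcases lt_or_gt_of_ne (Subtype.coe_ne_coe.2 hij) with h | h
    · change ⟪φ i, φ j⟫ = 0
      rw [real_inner_comm]
      exact inner_topVector_eq_zero (hne j) (residual_apply_topVector G h)
    · exact inner_topVector_eq_zero (hne i) (residual_apply_topVector G h)
  have hright : Orthonormal ℝ fun i : {i // σ i ≠ 0} => ψ i := by
    refine ⟨fun i => ?_, fun i j hij => ?_⟩
    · change ‖(σ i)⁻¹ • toCLM (residual G i) (φ i)‖ = 1
      rw [norm_smul, norm_apply_topVector, norm_inv, Real.norm_of_nonneg (norm_nonneg _)]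
      exact inv_mul_cancel₀ i.2
    · change ⟪ψ i, ψ j⟫ = 0
      simp only [hψ, real_inner_smul_left, real_inner_smul_right]
      rcases lt_or_gt_of_ne (Subtype.coe_ne_coe.2 hij) with h | h
      · rw [inner_residual_apply_topVector G h]; simp
      · rw [real_inner_comm, inner_residual_apply_topVector G h]; simp
  refine ⟨σ, φ, ψ, fun _ => norm_nonneg _, antitone_nat_of_succ_le fun n => ?_, hleft, hright,
    fun x => ?_⟩
  · simp only [hσ, residual_succ]
    exact norm_toCLM_deflate_le _
  have hterm : ∀ k, (σ k * ⟪φ k, x⟫) • ψ k = ⟪φ k, x⟫ • toCLM (residual G k) (φ k) := by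
    intro k
    rw [mul_comm, mul_smul, hσψ]
  simp only [hterm]
  -- Absolute convergence: `σ |⟪φ, x⟫| ≤ σ² + ⟪φ, x⟫²`, with Bessel's inequality for the last term.
  have hbessel : Summable ({i | σ i ≠ 0}.indicator fun k => ⟪φ k, x⟫ ^ 2) := by
    rw [← summable_subtype_iff_indicator]
    refine (hleft.inner_products_summable x).congr fun i => ?_
    rw [Real.norm_eq_abs, sq_abs, Function.comp_apply]
  have hsum : Summable fun k => ⟪φ k, x⟫ • toCLM (residual G k) (φ k) := by
    refine Summable.of_norm_bounded ((summable_sq_norm_residual G).add hbessel) fun k => ?_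
    rw [norm_smul, norm_apply_topVector, Real.norm_eq_abs]
    change |⟪φ k, x⟫| * σ k ≤ σ k ^ 2 + _
    by_cases h : σ k = 0
    · simp [h]
    · rw [Set.indicator_of_mem (show k ∈ {i | σ i ≠ 0} from h), ← sq_abs ⟪φ k, x⟫]
      nlinarith [sq_nonneg (|⟪φ k, x⟫| - σ k), sq_nonneg (|⟪φ k, x⟫|), sq_nonneg (σ k)]
  refine (hsum.hasSum_iff_tendsto_nat).2 ?_
  simp only [hφ, sum_residual_apply]
  simpa using (tendsto_residual_apply G x).const_sub (toCLM G x)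

end HilbertSchmidt

/-! ### Duality between the nuclear norm and the operator norm -/

open HilbertSchmidt

theorem IsSVD.norm_left_of_ne {G : E →L[ℝ] F} {σ : ℕ → ℝ} {φ : ℕ → E} {ψ : ℕ → F}
    (h : IsSVD G σ φ ψ) {k : ℕ} (hk : σ k ≠ 0) : ‖φ k‖ = 1 := h.orthonormal_left.1 ⟨k, hk⟩

theorem IsSVD.norm_right_of_ne {G : E →L[ℝ] F} {σ : ℕ → ℝ} {φ : ℕ → E} {ψ : ℕ → F}
    (h : IsSVD G σ φ ψ) {k : ℕ} (hk : σ k ≠ 0) : ‖ψ k‖ = 1 := h.orthonormal_right.1 ⟨k, hk⟩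

/-- If the singular values are summable, the singular value decomposition converges in the
Hilbert-Schmidt norm. -/
theorem IsSVD.hasSum_tensor {G : HilbertSchmidt E F} {σ : ℕ → ℝ} {φ : ℕ → E} {ψ : ℕ → F}
    (h : IsSVD (toCLM G) σ φ ψ) (hs : Summable σ) :
    HasSum (fun k => σ k • tensor (φ k) (ψ k)) G := by
  have hsum : Summable fun k => σ k • tensor (φ k) (ψ k) := by
    refine Summable.of_norm_bounded hs fun k => ?_
    rw [norm_smul, norm_tensor, Real.norm_of_nonneg (h.nonneg k)]
    by_cases hk : σ k = 0
    · simp [hk]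
    · rw [h.norm_left_of_ne hk, h.norm_right_of_ne hk]; simp
  -- The sum is `G`: evaluation at `x` is continuous for the Hilbert-Schmidt norm.
  convert hsum.hasSum using 1
  refine toCLM_injective (ContinuousLinearMap.ext fun x => ?_)
  refine (h.hasSum x).unique ?_
  have := (hsum.hasSum.mapL (toCLML E F)).mapL (ContinuousLinearMap.apply ℝ F x)
  simpa [tensor_apply, smul_smul] using this

theorem ofReal_inner_le_nuclearNorm (G K : HilbertSchmidt E F) (hK : ‖toCLM K‖ ≤ 1) :
    ENNReal.ofReal ⟪G, K⟫ ≤ nuclearNorm G := by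
  refine le_iInf₂ fun σ hσ => ?_
  obtain ⟨φ, ψ, h⟩ := hσ
  by_cases htop : ∑' j, ENNReal.ofReal (σ j) = ∞
  · rw [htop]; exact le_top
  have hs : Summable σ := (summable_iff_tsum_ofReal_ne_top h.nonneg).2 htop
  rw [← ENNReal.ofReal_tsum_of_nonneg h.nonneg hs]
  refine ENNReal.ofReal_le_ofReal ?_
  have h1 := (h.hasSum_tensor hs).mapL (innerSL ℝ K)
  simp only [innerSL_apply_apply, real_inner_smul_right, inner_tensor_right] at h1
  rw [real_inner_comm]
  refine hasSum_le (fun k => ?_) h1 hs.hasSum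
  by_cases hk : σ k = 0
  · simp [hk]
  refine mul_le_of_le_one_right (h.nonneg k) ((real_inner_le_norm _ _).trans ?_)
  rw [h.norm_right_of_ne hk, mul_one]
  simpa [h.norm_left_of_ne hk] using (toCLM K).le_of_opNorm_le hK (φ k)

/-- A finite sum of rank-one operators built from two orthonormal families is a contraction. -/
theorem norm_toCLM_sum_tensor_le_one {ι : Type*} {φ : ι → E} {ψ : ι → F} (hφ : Orthonormal ℝ φ)
    (hψ : Orthonormal ℝ ψ) (s : Finset ι) : ‖toCLM (∑ i ∈ s, tensor (φ i) (ψ i))‖ ≤ 1 := by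
  refine ContinuousLinearMap.opNorm_le_bound _ zero_le_one fun x => ?_
  rw [one_mul, ← sq_le_sq₀ (norm_nonneg _) (norm_nonneg _)]
  have h1 : toCLM (∑ i ∈ s, tensor (φ i) (ψ i)) x = ∑ i ∈ s, ⟪φ i, x⟫ • ψ i := by
    simp [map_sum, tensor_apply]
  rw [h1, ← real_inner_self_eq_norm_sq, hψ.inner_sum]
  have := hφ.sum_inner_products_le x (s := s)
  simpa [sq] using this

/-- The nuclear norm is the dual of the operator norm. -/
theorem nuclearNorm_eq_iSup (G : HilbertSchmidt E F) :
    nuclearNorm G =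
      ⨆ K : {K : HilbertSchmidt E F // ‖toCLM K‖ ≤ 1}, ENNReal.ofReal ⟪G, K.1⟫ := by
  refine le_antisymm ?_ (iSup_le fun K => ofReal_inner_le_nuclearNorm G K.1 K.2)
  obtain ⟨σ, hσ⟩ := exists_isSingularValueSeq G
  rw [nuclearNorm_eq hσ]
  obtain ⟨φ, ψ, h⟩ := hσ
  have e : ∑' i, ENNReal.ofReal (σ i) = ∑' i : {i // σ i ≠ 0}, ENNReal.ofReal (σ i) := by
    symm
    refine tsum_subtype_eq_of_support_subset (f := fun i => ENNReal.ofReal (σ i))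
      (s := {i | σ i ≠ 0}) fun i hi hi0 => hi ?_
    simp [hi0]
  rw [e, ENNReal.tsum_eq_iSup_sum]
  refine iSup_le fun s => ?_
  rw [← ENNReal.ofReal_sum_of_nonneg fun (i : {i // σ i ≠ 0}) _ => h.nonneg i]
  refine le_iSup_of_le ⟨_, norm_toCLM_sum_tensor_le_one h.orthonormal_left h.orthonormal_right s⟩
    (ENNReal.ofReal_le_ofReal (le_of_eq ?_))
  rw [inner_sum]
  refine Finset.sum_congr rfl fun i _ => ?_
  rw [inner_tensor_right, real_inner_comm, h.inner_apply i]

theorem norm_le_nuclearNorm (G : HilbertSchmidt E F) : ENNReal.ofReal ‖G‖ ≤ nuclearNorm G := by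
  rcases eq_or_ne G 0 with rfl | h0
  · simp
  have hG := norm_pos_iff.2 h0
  have h1 : ‖toCLM (‖G‖⁻¹ • G)‖ ≤ 1 := by
    refine (norm_toCLM_le _).trans (le_of_eq ?_)
    rw [norm_smul, norm_inv, norm_norm, inv_mul_cancel₀ hG.ne']
  have h2 := ofReal_inner_le_nuclearNorm G _ h1
  rwa [real_inner_smul_right, real_inner_self_eq_norm_sq, sq, inv_mul_cancel_left₀ hG.ne'] at h2

theorem nuclearNorm_smul_tensor_le {c : ℝ} (hc : 0 ≤ c) {u : E} {v : F} (hu : ‖u‖ ≤ 1)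
    (hv : ‖v‖ ≤ 1) : nuclearNorm (c • tensor u v) ≤ ENNReal.ofReal c := by
  rw [nuclearNorm_eq_iSup]
  refine iSup_le fun K => ENNReal.ofReal_le_ofReal ?_
  rw [real_inner_smul_left, inner_tensor_left]
  refine mul_le_of_le_one_right hc ((real_inner_le_norm _ _).trans ?_)
  exact mul_le_one₀ hv (norm_nonneg _)
    (((toCLM K.1).le_of_opNorm_le K.2 u).trans (by rwa [one_mul]))

theorem nuclearNorm_zero : nuclearNorm (0 : HilbertSchmidt E F) = 0 := by
  simp [nuclearNorm_eq_iSup]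

theorem nuclearNorm_combo_le (X Y : HilbertSchmidt E F) {a b : ℝ} (ha : 0 ≤ a) (hb : 0 ≤ b) :
    nuclearNorm (a • X + b • Y) ≤
      ENNReal.ofReal a * nuclearNorm X + ENNReal.ofReal b * nuclearNorm Y := by
  rw [nuclearNorm_eq_iSup (a • X + b • Y)]
  refine iSup_le fun K => ?_
  rw [inner_add_left, real_inner_smul_left, real_inner_smul_left]
  refine ENNReal.ofReal_add_le.trans ?_
  rw [ENNReal.ofReal_mul ha, ENNReal.ofReal_mul hb]
  gcongr <;> exact ofReal_inner_le_nuclearNorm _ K.1 K.2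

theorem lowerSemicontinuous_nuclearNorm :
    LowerSemicontinuous (nuclearNorm : HilbertSchmidt E F → ℝ≥0∞) := by
  rw [funext (nuclearNorm_eq_iSup (E := E) (F := F))]
  exact lowerSemicontinuous_iSup fun K =>
    (ENNReal.continuous_ofReal.comp (by fun_prop)).lowerSemicontinuous

/-! ### The objective -/

variable {H : Type*} [NormedAddCommGroup H] [InnerProductSpace ℝ H] [CompleteSpace H] {N : ℕ}

theorem lowerSemicontinuous_objective :
    LowerSemicontinuous (objective : OpTuple N E F → ℝ≥0∞) :=
  lowerSemicontinuous_sum fun i _ => lowerSemicontinuous_nuclearNorm.comp (by fun_prop)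

theorem isClosed_objective_le (c : ℝ≥0∞) : IsClosed {X : OpTuple N E F | objective X ≤ c} :=
  lowerSemicontinuous_objective.isClosed_preimage c

theorem convex_objective_le (c : ℝ≥0∞) : Convex ℝ {X : OpTuple N E F | objective X ≤ c} := by
  intro X hX Y hY a b ha hb hab
  calc objective (a • X + b • Y)
      ≤ ENNReal.ofReal a * objective X + ENNReal.ofReal b * objective Y := by
        simp only [objective, Finset.mul_sum, ← Finset.sum_add_distrib]
        exact Finset.sum_le_sum fun i _ => nuclearNorm_combo_le _ _ ha hb
    _ ≤ ENNReal.ofReal a * c + ENNReal.ofReal b * c := by gcongr <;> assumption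
    _ = c := by rw [← add_mul, ← ENNReal.ofReal_add ha hb, hab, ENNReal.ofReal_one, one_mul]

theorem isBounded_objective_le {c : ℝ≥0∞} (hc : c ≠ ∞) :
    Bornology.IsBounded {X : OpTuple N E F | objective X ≤ c} := by
  refine isBounded_iff_forall_norm_le.2 ⟨√(∑ _i : Fin N, c.toReal ^ 2), fun X hX => ?_⟩
  rw [PiLp.norm_eq_of_L2]
  refine Real.sqrt_le_sqrt (Finset.sum_le_sum fun i _ => ?_)
  refine pow_le_pow_left₀ (norm_nonneg _) ((ENNReal.ofReal_le_iff_le_toReal hc).1 ?_) 2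
  exact (norm_le_nuclearNorm _).trans
    ((Finset.single_le_sum (f := fun i => nuclearNorm (X i)) (fun _ _ => zero_le)
      (Finset.mem_univ i)).trans hX)

theorem objective_rankOneTuple_ne_top {σ : Fin N → ℝ} {u : Fin N → E} {v : Fin N → F}
    (hσ : ∀ i, 0 ≤ σ i) (hu : ∀ i, ‖u i‖ ≤ 1) (hv : ∀ i, ‖v i‖ ≤ 1) :
    objective (rankOneTuple σ u v) ≠ ∞ :=
  ENNReal.sum_ne_top.2 fun i _ =>
    ((nuclearNorm_smul_tensor_le (hσ i) (hu i) (hv i)).trans_lt ENNReal.ofReal_lt_top).ne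

theorem objective_single (i : Fin N) (G : HilbertSchmidt E F) :
    objective (PiLp.single 2 i G : OpTuple N E F) = nuclearNorm G := by
  rw [objective, Finset.sum_eq_single i]
  · simp
  · intro j _ hj
    simp [hj, nuclearNorm_zero]
  · simp

/-! ### Nested closed convex sets in a Hilbert space -/

/-- A decreasing sequence of nonempty bounded closed convex sets in a Hilbert space has a common
point: the points of minimal norm form a Cauchy sequence. -/
theorem nonempty_iInter_of_antitone_convex {V : Type*} [NormedAddCommGroup V]
    [InnerProductSpace ℝ V] [CompleteSpace V] {C : ℕ → Set V} (hanti : Antitone C)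
    (hconv : ∀ n, Convex ℝ (C n)) (hclosed : ∀ n, IsClosed (C n)) (hne : ∀ n, (C n).Nonempty)
    (hbdd : Bornology.IsBounded (C 0)) : (⋂ n, C n).Nonempty := by
  have hmin : ∀ n, ∃ x ∈ C n, ∀ y ∈ C n, 0 ≤ ⟪x, y - x⟫ := by
    intro n
    obtain ⟨x, hx, hx'⟩ := exists_norm_eq_iInf_of_complete_convex (hne n)
      (hclosed n).isComplete (hconv n) 0
    refine ⟨x, hx, fun y hy => ?_⟩
    have := (norm_eq_iInf_iff_real_inner_le_zero (hconv n) hx).1 hx' y hy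
    rw [zero_sub, inner_neg_left] at this
    linarith
  choose x hx hxmin using hmin
  obtain ⟨R, hR⟩ := isBounded_iff_forall_norm_le.1 hbdd
  have hdist : ∀ n m, n ≤ m → ‖x m - x n‖ ^ 2 ≤ ‖x m‖ ^ 2 - ‖x n‖ ^ 2 := by
    intro n m hnm
    have h1 := hxmin n (x m) (hanti hnm (hx m))
    rw [inner_sub_right, real_inner_self_eq_norm_sq] at h1
    rw [norm_sub_sq_real, real_inner_comm]
    linarith
  have hmono : Monotone fun n => ‖x n‖ ^ 2 := fun n m hnm => by
    have := hdist n m hnm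
    have := sq_nonneg ‖x m - x n‖
    change ‖x n‖ ^ 2 ≤ ‖x m‖ ^ 2
    linarith
  have hbd : BddAbove (Set.range fun n => ‖x n‖ ^ 2) := by
    refine ⟨R ^ 2, ?_⟩
    rintro _ ⟨n, rfl⟩
    exact pow_le_pow_left₀ (norm_nonneg _) (hR _ (hanti (Nat.zero_le n) (hx n))) 2
  have hlim := tendsto_atTop_ciSup hmono hbd
  set l := ⨆ n, ‖x n‖ ^ 2
  have hcauchy : CauchySeq x := by
    refine cauchySeq_of_le_tendsto_0 (fun n => √(l - ‖x n‖ ^ 2) + √(l - ‖x n‖ ^ 2)) ?_ ?_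
    · have h1 : ∀ k m, k ≤ m → dist (x m) (x k) ≤ √(l - ‖x k‖ ^ 2) := by
        intro k m hkm
        rw [dist_eq_norm]
        refine Real.le_sqrt_of_sq_le ((hdist k m hkm).trans ?_)
        linarith [le_ciSup hbd m]
      intro n m k hn hm
      refine (dist_triangle_right _ _ (x k)).trans (add_le_add (h1 k n hn) (h1 k m hm))
    · have h2 := (hlim.const_sub l).sqrt
      simpa using h2.add h2
  obtain ⟨a, ha⟩ := cauchySeq_tendsto_of_complete hcauchy
  refine ⟨a, Set.mem_iInter.2 fun n => (hclosed n).mem_of_tendsto ha ?_⟩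
  filter_upwards [Filter.eventually_ge_atTop n] with m hm using hanti hm (hx m)

/-- A bounded linear operator between Hilbert spaces maps bounded closed convex sets to closed
sets. -/
theorem isClosed_image_of_convex_of_isBounded {V W : Type*} [NormedAddCommGroup V]
    [InnerProductSpace ℝ V] [CompleteSpace V] [NormedAddCommGroup W] [NormedSpace ℝ W]
    (T : V →L[ℝ] W) {S : Set V} (hconv : Convex ℝ S) (hclosed : IsClosed S)
    (hbdd : Bornology.IsBounded S) : IsClosed (T '' S) := by
  refine isClosed_of_closure_subset fun w hw => ?_
  let C : ℕ → Set V := fun n => S ∩ T ⁻¹' Metric.closedBall w (1 / ((n : ℝ) + 1))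
  obtain ⟨x, hx⟩ := nonempty_iInter_of_antitone_convex (C := C)
    (fun n m hnm => Set.inter_subset_inter_right _ (Set.preimage_mono
      (Metric.closedBall_subset_closedBall (Nat.one_div_le_one_div hnm))))
    (fun n => hconv.inter ((convex_closedBall _ _).linear_preimage T.toLinearMap))
    (fun n => hclosed.inter (Metric.isClosed_closedBall.preimage T.continuous))
    (fun n => by
      obtain ⟨_, ⟨y, hy, rfl⟩, hyw⟩ := Metric.mem_closure_iff.1 hw _
        (Nat.one_div_pos_of_nat (n := n))
      exact ⟨y, hy, by rw [Set.mem_preimage, Metric.mem_closedBall, dist_comm]; exact hyw.le⟩)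
    (hbdd.subset Set.inter_subset_left)
  rw [Set.mem_iInter] at hx
  refine ⟨x, (hx 0).1, dist_le_zero.1 ?_⟩
  exact ge_of_tendsto' tendsto_one_div_add_atTop_nhds_zero_nat fun n => (hx n).2

/-! ### Weak duality -/

theorem coe_finset_sum {ι : Type*} (s : Finset ι) (f : ι → ℝ) :
    ((∑ i ∈ s, f i : ℝ) : EReal) = ∑ i ∈ s, (f i : EReal) :=
  map_sum (⟨⟨Real.toEReal, EReal.coe_zero⟩, EReal.coe_add⟩ : ℝ →+ EReal) f s

theorem coe_ennreal_finset_sum {ι : Type*} (s : Finset ι) (f : ι → ℝ≥0∞) :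
    ((∑ i ∈ s, f i : ℝ≥0∞) : EReal) = ∑ i ∈ s, (f i : EReal) :=
  map_sum (⟨⟨(↑), EReal.coe_ennreal_zero⟩, EReal.coe_ennreal_add⟩ : ℝ≥0∞ →+ EReal) f s

theorem coe_inner_le_nuclearNorm {Φ : OpTuple N E F →L[ℝ] H} {p : H} (hp : DualFeasible Φ p)
    (X : OpTuple N E F) (i : Fin N) :
    ((⟪X i, ContinuousLinearMap.adjoint Φ p i⟫ : ℝ) : EReal) ≤ nuclearNorm (X i) := by
  have h := EReal.coe_ennreal_le_coe_ennreal_iff.2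
    (ofReal_inner_le_nuclearNorm (X i) (ContinuousLinearMap.adjoint Φ p i) (hp i))
  rw [EReal.coe_ennreal_ofReal] at h
  exact (EReal.coe_le_coe_iff.2 (le_max_left _ _)).trans h

theorem inner_apply_eq_sum (Φ : OpTuple N E F →L[ℝ] H) (p : H) (X : OpTuple N E F) :
    ⟪p, Φ X⟫ = ∑ i, ⟪X i, ContinuousLinearMap.adjoint Φ p i⟫ := by
  rw [real_inner_comm, ← ContinuousLinearMap.adjoint_inner_right, PiLp.inner_apply]

theorem coe_objective (X : OpTuple N E F) :
    (objective X : EReal) = ∑ i, (nuclearNorm (X i) : EReal) := by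
  rw [objective, coe_ennreal_finset_sum]

theorem coe_inner_eq_sum (Φ : OpTuple N E F →L[ℝ] H) (p : H) (X : OpTuple N E F) :
    ((⟪p, Φ X⟫ : ℝ) : EReal) =
      ∑ i, ((⟪X i, ContinuousLinearMap.adjoint Φ p i⟫ : ℝ) : EReal) := by
  rw [inner_apply_eq_sum, coe_finset_sum]

theorem coe_inner_le_objective {Φ : OpTuple N E F →L[ℝ] H} {p : H} (hp : DualFeasible Φ p)
    (X : OpTuple N E F) : ((⟪p, Φ X⟫ : ℝ) : EReal) ≤ objective X := by
  rw [coe_inner_eq_sum, coe_objective]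
  exact Finset.sum_le_sum fun i _ => coe_inner_le_nuclearNorm hp X i

/-- Complementarity: without a duality gap, each of the termwise inequalities behind weak duality is
an equality. The objective is finite here, being the value of an inner product. -/
theorem coe_inner_eq_nuclearNorm {Φ : OpTuple N E F →L[ℝ] H} {p : H} (hp : DualFeasible Φ p)
    {X : OpTuple N E F} (h : ((⟪p, Φ X⟫ : ℝ) : EReal) = objective X) (i : Fin N) :
    ((⟪X i, ContinuousLinearMap.adjoint Φ p i⟫ : ℝ) : EReal) = nuclearNorm (X i) := by
  have htop : objective X ≠ ∞ := by
    intro h'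
    rw [h', EReal.coe_ennreal_top] at h
    exact EReal.coe_ne_top _ h
  have hreal : ∀ i, (((nuclearNorm (X i)).toReal : ℝ) : EReal) = nuclearNorm (X i) := fun i =>
    EReal.coe_ennreal_toReal (ENNReal.sum_ne_top.1 htop i (Finset.mem_univ i))
  have hle : ∀ i ∈ Finset.univ,
      ⟪X i, ContinuousLinearMap.adjoint Φ p i⟫ ≤ (nuclearNorm (X i)).toReal := fun i _ => by
    rw [← EReal.coe_le_coe_iff, hreal]
    exact coe_inner_le_nuclearNorm hp X i
  rw [coe_inner_eq_sum, coe_objective] at h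
  simp only [← hreal, ← coe_finset_sum, EReal.coe_eq_coe_iff] at h
  rw [← hreal, (Finset.sum_eq_sum_iff_of_le hle).1 h i (Finset.mem_univ i)]

theorem dualValue_le_objective {Φ : OpTuple N E F →L[ℝ] H} (X : OpTuple N E F) :
    dualValue Φ (Φ X) ≤ objective X :=
  iSup₂_le fun _ hp => coe_inner_le_objective hp X

theorem IsPrimalSolution.primalValue_eq {Φ : OpTuple N E F →L[ℝ] H} {z : H} {X : OpTuple N E F}
    (h : IsPrimalSolution Φ z X) : primalValue Φ z = objective X :=
  le_antisymm (iInf₂_le X h.1)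
    (le_iInf₂ fun Y hY => EReal.coe_ennreal_le_coe_ennreal_iff.2 (h.2 Y hY))

theorem IsDualSolution.dualValue_eq {Φ : OpTuple N E F →L[ℝ] H} {z p : H}
    (h : IsDualSolution Φ z p) : dualValue Φ z = ((⟪p, z⟫ : ℝ) : EReal) :=
  le_antisymm (iSup₂_le fun q hq => EReal.coe_le_coe_iff.2 (h.2 q hq))
    (le_iSup₂ (f := fun (p : H) (_ : DualFeasible Φ p) => ((⟪p, z⟫ : ℝ) : EReal)) p h.1)

/-! ### Existence of a minimizer -/

theorem exists_isPrimalSolution (Φ : OpTuple N E F →L[ℝ] H) {z : H} {X₀ : OpTuple N E F}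
    (hX₀ : Φ X₀ = z) (hfin : objective X₀ ≠ ∞) : ∃ X, IsPrimalSolution Φ z X := by
  set m : ℝ≥0∞ := ⨅ (X : OpTuple N E F) (_ : Φ X = z), objective X with hm
  have hmle : ∀ Y, Φ Y = z → m ≤ objective Y := fun Y hY => iInf₂_le Y hY
  have hmtop : m ≠ ∞ := ((hmle X₀ hX₀).trans_lt hfin.lt_top).ne
  -- Intersect the closed convex sets of feasible points of objective at most `m + 1 / (n + 1)`.
  let ε : ℕ → ℝ≥0∞ := fun n => ((n : ℝ≥0∞) + 1)⁻¹
  have hε : ∀ n, ε n ≠ 0 := fun n => ENNReal.inv_ne_zero.2 (by simp)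
  have hεtop : ∀ n, ε n ≠ ∞ := fun n => ENNReal.inv_ne_top.2 (by simp)
  obtain ⟨X, hX⟩ := nonempty_iInter_of_antitone_convex
    (C := fun n => {X : OpTuple N E F | objective X ≤ m + ε n} ∩ Φ ⁻¹' {z})
    (fun n k hnk => Set.inter_subset_inter_left _ fun X hX => le_trans hX (by
      change m + ε k ≤ m + ε n
      have : (n : ℝ≥0∞) ≤ k := by exact_mod_cast hnk
      exact add_le_add_right (ENNReal.inv_le_inv.2 (add_le_add_left this 1)) m))
    (fun n => (convex_objective_le _).inter ((convex_singleton z).linear_preimage Φ.toLinearMap))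
    (fun n => (isClosed_objective_le _).inter (isClosed_singleton.preimage Φ.continuous))
    (fun n => by
      obtain ⟨Y, hlt⟩ := iInf_lt_iff.1 (ENNReal.lt_add_right hmtop (hε n))
      obtain ⟨hY, hlt⟩ := iInf_lt_iff.1 hlt
      exact ⟨Y, hlt.le, hY⟩)
    ((isBounded_objective_le (ENNReal.add_ne_top.2 ⟨hmtop, hεtop 0⟩)).subset
      Set.inter_subset_left)
  rw [Set.mem_iInter] at hX
  refine ⟨X, (hX 0).2, fun Y hY => le_trans ?_ (hmle Y hY)⟩
  have hlim : Filter.Tendsto (fun n => m + ε n) Filter.atTop (nhds (m + 0)) := by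
    refine Filter.Tendsto.const_add m ?_
    have := (Filter.tendsto_add_atTop_iff_nat 1).2 ENNReal.tendsto_inv_nat_nhds_zero
    simpa [ε] using this
  rw [add_zero] at hlim
  exact ge_of_tendsto' hlim fun n => (hX n).1

/-! ### Strong duality -/

/-- If the linear functional of `p` is at most `c` on the sublevel set of level `c > 0`, then `p` is
dual feasible: test with rank-one operators. -/
theorem dualFeasible_of_forall_objective_le {Φ : OpTuple N E F →L[ℝ] H} {q : H} {c : ℝ}
    (hc : 0 < c)
    (h : ∀ X, objective X ≤ ENNReal.ofReal c → ⟪q, Φ X⟫ ≤ c) : DualFeasible Φ q := by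
  intro i
  -- With `v` the direction of `K x`, the pairing of `K` with `c • x ⊗ v` is `c * ‖K x‖`.
  set K := ContinuousLinearMap.adjoint Φ q i with hK
  refine ContinuousLinearMap.opNorm_le_of_unit_norm zero_le_one fun x hx => ?_
  rcases eq_or_ne (toCLM K x) 0 with h0 | h0
  · rw [h0, norm_zero]; exact zero_le_one
  have hpos := norm_pos_iff.2 h0
  set v := ‖toCLM K x‖⁻¹ • toCLM K x with hv
  have hv1 : ‖v‖ = 1 := by rw [hv, norm_smul, norm_inv, norm_norm, inv_mul_cancel₀ hpos.ne']
  have h1 := h (PiLp.single 2 i (c • tensor x v)) (by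
    rw [objective_single]
    exact nuclearNorm_smul_tensor_le hc.le hx.le hv1.le)
  rw [inner_apply_eq_sum, Finset.sum_eq_single i] at h1
  · rw [PiLp.single_apply, if_pos rfl, ← hK, real_inner_smul_left, inner_tensor_left, hv,
      real_inner_smul_left, real_inner_self_eq_norm_sq, sq, inv_mul_cancel_left₀ hpos.ne'] at h1
    exact le_of_mul_le_mul_left (by rwa [mul_one]) hc
  · intro j _ hj
    simp [hj]
  · simp

/-- Separating `z` from the image of the sublevel set of level `c` gives a dual feasible point of
value at least `c`. -/
theorem exists_dualFeasible_le_inner {Φ : OpTuple N E F →L[ℝ] H} {z : H} {c : ℝ} (hc : 0 < c)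
    (h : ∀ X, Φ X = z → ENNReal.ofReal c < objective X) :
    ∃ q, DualFeasible Φ q ∧ c ≤ ⟪q, z⟫ := by
  set S := {X : OpTuple N E F | objective X ≤ ENNReal.ofReal c}
  have hz : z ∉ Φ '' S := by
    rintro ⟨X, hX, hXz⟩
    exact (h X hXz).not_ge hX
  obtain ⟨f, s, hf, hs⟩ := geometric_hahn_banach_closed_point
    ((convex_objective_le _).linear_image Φ.toLinearMap)
    (isClosed_image_of_convex_of_isBounded Φ (convex_objective_le _) (isClosed_objective_le _)
      (isBounded_objective_le ENNReal.ofReal_ne_top)) hz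
  -- The sublevel set contains `0`, so the separating level is positive and can be scaled to `c`.
  have hs0 : 0 < s := by
    have := hf (Φ 0) ⟨0, by simp [objective, nuclearNorm_zero], rfl⟩
    simpa using this
  have hcs : 0 ≤ c / s := by positivity
  refine ⟨(c / s) • (InnerProductSpace.toDual ℝ H).symm f,
    dualFeasible_of_forall_objective_le hc fun X hX => ?_, ?_⟩
  · rw [real_inner_smul_left, InnerProductSpace.toDual_symm_apply]
    calc c / s * f (Φ X) ≤ c / s * s := mul_le_mul_of_nonneg_left (hf _ ⟨X, hX, rfl⟩).le hcs
      _ = c := div_mul_cancel₀ c hs0.ne'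
  · rw [real_inner_smul_left, InnerProductSpace.toDual_symm_apply]
    calc c = c / s * s := (div_mul_cancel₀ c hs0.ne').symm
      _ ≤ c / s * f z := mul_le_mul_of_nonneg_left hs.le hcs

theorem IsPrimalSolution.objective_eq_dualValue {Φ : OpTuple N E F →L[ℝ] H} {z : H}
    {X : OpTuple N E F} (h : IsPrimalSolution Φ z X) :
    (objective X : EReal) = dualValue Φ z := by
  refine le_antisymm (EReal.ge_of_forall_gt_iff_ge.1 fun c hc => ?_)
    (h.1 ▸ dualValue_le_objective X)
  have hle : ∀ q, DualFeasible Φ q → ((⟪q, z⟫ : ℝ) : EReal) ≤ dualValue Φ z := fun q hq =>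
    le_iSup₂ (f := fun (p : H) (_ : DualFeasible Φ p) => ((⟪p, z⟫ : ℝ) : EReal)) q hq
  rcases le_or_gt c 0 with hc0 | hc0
  · refine le_trans ?_ (hle 0 fun i => by simp)
    rw [inner_zero_left]
    exact EReal.coe_le_coe_iff.2 hc0
  · obtain ⟨q, hq, hcq⟩ := exists_dualFeasible_le_inner (Φ := Φ) (z := z) hc0 fun Y hY => by
      refine lt_of_lt_of_le ?_ (h.2 Y hY)
      rw [← EReal.coe_ennreal_lt_coe_ennreal_iff, EReal.coe_ennreal_ofReal, max_eq_left hc0.le]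
      exact hc
    exact (EReal.coe_le_coe_iff.2 hcq).trans (hle q hq)

end NuclearMin

end

theorem mainTheorem4 {H₁ H₂ H : Type*}
    [NormedAddCommGroup H₁] [InnerProductSpace ℝ H₁] [CompleteSpace H₁]
    [TopologicalSpace.SeparableSpace H₁]
    [NormedAddCommGroup H₂] [InnerProductSpace ℝ H₂] [CompleteSpace H₂]
    [TopologicalSpace.SeparableSpace H₂]
    [NormedAddCommGroup H] [InnerProductSpace ℝ H] [CompleteSpace H]
    [TopologicalSpace.SeparableSpace H]
    (N : ℕ) (σ : Fin N → ℝ) (u : Fin N → H₁) (v : Fin N → H₂)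
    (hσ : ∀ i, 0 < σ i) (hu : ∀ i, ‖u i‖ = 1) (hv : ∀ i, ‖v i‖ = 1)
    (Φ : NuclearMin.OpTuple N H₁ H₂ →L[ℝ] H)
    (z : H) (hz : z = Φ (NuclearMin.rankOneTuple σ u v)) :
    (∃ X, NuclearMin.IsPrimalSolution Φ z X) ∧
    NuclearMin.primalValue Φ z = NuclearMin.dualValue Φ z ∧
    (∀ p, NuclearMin.IsDualSolution Φ z p → ∀ X, NuclearMin.IsPrimalSolution Φ z X →
      ∀ i, ((⟪X i, ContinuousLinearMap.adjoint Φ p i⟫ : ℝ) : EReal) =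
        NuclearMin.nuclearNorm (X i)) ∧
    (∀ (X : NuclearMin.OpTuple N H₁ H₂) (p : H), Φ X = z →
      (∀ i, ((⟪X i, ContinuousLinearMap.adjoint Φ p i⟫ : ℝ) : EReal) =
        NuclearMin.nuclearNorm (X i)) →
      (∀ i, ‖(ContinuousLinearMap.adjoint Φ p i).toCLM‖ ≤ 1) →
      NuclearMin.IsPrimalSolution Φ z X ∧ NuclearMin.IsDualSolution Φ z p) := by
  obtain ⟨X₀, hX₀⟩ := NuclearMin.exists_isPrimalSolution Φ hz.symm
    (NuclearMin.objective_rankOneTuple_ne_top (fun i => (hσ i).le) (fun i => (hu i).le)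
      fun i => (hv i).le)
  refine ⟨⟨X₀, hX₀⟩, hX₀.primalValue_eq.trans hX₀.objective_eq_dualValue, ?_, ?_⟩
  · intro p hp X hX
    refine NuclearMin.coe_inner_eq_nuclearNorm hp.1 ?_
    rw [hX.objective_eq_dualValue, hp.dualValue_eq, hX.1]
  · intro X p hX heq hp
    have hobj : ((⟪p, z⟫ : ℝ) : EReal) = NuclearMin.objective X := by
      rw [← hX, NuclearMin.coe_inner_eq_sum, NuclearMin.coe_objective]
      exact Finset.sum_congr rfl fun i _ => heq i
    refine ⟨⟨hX, fun Y hY => ?_⟩, hp, fun q hq => ?_⟩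
    · rw [← EReal.coe_ennreal_le_coe_ennreal_iff, ← hobj, ← hY]
      exact NuclearMin.coe_inner_le_objective hp Y
    · rw [← EReal.coe_le_coe_iff, hobj, ← hX]
      exact NuclearMin.coe_inner_le_objective hq X
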